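/- **Setting.** Let $\Omega^d$ be the set of continuous paths $S=(S^1,\dots,S^d):[0,\infty)\to(0,\infty)^d$. For $s,t\ge 0$ let $r_S(s,t)\in\mathbb R^d$ be the return vector with components $(S^j(t)-S^j(s))/S^j(s)$; $\|\cdot\|$ is the Euclidean norm. *Trading times.* For $\delta>0$ put $t_0=0$ and let $t_{i+1}$ be the first time $t>t_i$ with $\|r_S(t_i,t)\|=\delta$ ($t_{i+1}=\infty$ if there is none). Let $x_{n}=r_S(t_{n-1},t_{n})$, $n\ge1$, and for $T>0$ define $N=N(T,\delta,S)$ by $t_N<T\le t_{N+1}$. Put $V_N=\sum_{n=1}^N x_nx_n^{\mathrm t}$. *Training data.* Fix $\epsilon_0\in(0,1)$ and $n_0$. For each $\delta>0$ let training vectors $x_{-n_0+1},\dots,x_0\in\mathbb R^d$ (depending on $\delta$) be given, of order $O(\delta)$ as $\delta\to0$, such that for all $\alpha\in\mathbb R^d$: if $1+\alpha\cdot x_n\ge0$ for $n=-n_0+1,\dots,0$, then $1+\alpha\cdot x\ge\epsilon_0$ for all $x$ with $\|x\|=\delta$. *Sequential optimizing strategy.* Let $\alpha_n^*$ be the maximizer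 of $\alpha\mapsto\sum_{i=-n_0+1}^{n}\log(1+\alpha\cdot x_i)$ over the $\alpha$ for which all $1+\alpha\cdot x_i$ are positive. Starting with capital $1$, Investor bets the proportion vector $\alpha_{n}^*$ during $[t_{n},t_{n+1})$, $n\ge 0$, so that his capital at time $T$ is $$\mathcal K_\delta(T)=\Big(\prod_{n=1}^N(1+\alpha_{n-1}^*\cdot x_n)\Big)\big(1+\alpha_N^*\cdot r_S(t_N,T)\big).$$ *Classes of paths.* For $A>0$, $T>0$, $0<H<1$ let - $E_{A,0,T}$ be the set of $S\in\Omega^d$ for which there is $j$ with $|\log S^j(x)-\log S^j(y)|\le A$ for all $0\le x<y\le T$; - $E'_T$ be the set of $S\in\Omega^d$ with $\delta\,\alpha^*_{N(T,\delta,S)}\to0$ as $\delta\to0$; - $E_{H,T}$ be the set of $S\in\Omega^d$ with $0<\liminf_{\delta\to0}\dfrac{\operatorname{tr}V_N}{\delta^{2-1/H}}\le\limsup_{\delta\to0}\dfrac{\operatorname{tr}V_N}{\delta^{2-1/H}}<\infty$. **Theorem.** The strategy observes the collateral duty: $\mathcal K_\delta(t)\ge0$ for all $S\in\Omega^d$,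 $\delta>0$, $t\ge0$. Moreover Investor can essentially force $H=1/2$ for $S\in E_{A,0,T}^c$ in the following sense. Let $T>0$, $A>0$, $0<H<1$, $H\ne\frac12$, and let $S\in E_{A,0,T}^c\cap E_T'\cap E_{H,T}$, where in case $H>\frac12$ it is also assumed that $S(T)\ne S(0)$. Then $$\mathcal K_\delta(T)\to\infty\quad\text{as }\delta\to0.$$ -/

import Mathlib

open Filter Topology Set
open scoped NNReal ENNReal

noncomputable section

namespace TradingGame

/-- The space of returns, with the Euclidean norm and the standard inner product. -/
abbrev Vec (d : ℕ) : Type := EuclideanSpace ℝ (Fin d)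

/-! ### The sequential optimizing strategy in the discrete-time game

The `n₀` training vectors are indexed by `Fin n₀`; the move of round `n + 1` is `x n`, so that
the moves of the first `N` rounds are `x 0, …, x (N - 1)`. -/

/-- `u` is admissible training data for the move space `D` with margin `ε₀`. -/
def IsTrainingData {d n₀ : ℕ} (ε₀ : ℝ) (D : Set (Vec d)) (u : Fin n₀ → Vec d) : Prop :=
  ∀ α : Vec d, (∀ i, 0 ≤ 1 + inner ℝ α (u i)) → ∀ y ∈ D, ε₀ ≤ 1 + inner ℝ α y

/-- The constant betting proportions for which every factor, over the training data and the first
`N` rounds, is positive. -/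
def admissible {d n₀ : ℕ} (u : Fin n₀ → Vec d) (x : ℕ → Vec d) (N : ℕ) : Set (Vec d) :=
  {α | (∀ i, 0 < 1 + inner ℝ α (u i)) ∧ ∀ n < N, 0 < 1 + inner ℝ α (x n)}

/-- Log capital, training data included, of the constant proportional betting strategy `α` after
`N` rounds. -/
def logCapital {d n₀ : ℕ} (u : Fin n₀ → Vec d) (x : ℕ → Vec d) (N : ℕ) (α : Vec d) : ℝ :=
  ∑ i, Real.log (1 + inner ℝ α (u i)) + ∑ n ∈ Finset.range N, Real.log (1 + inner ℝ α (x n))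

/-- The hindsight optimal constant proportion after `N` rounds: the maximizer of `logCapital`
(it exists and is unique as soon as `u` is training data for a set `D` that contains the moves
and has the origin in the interior of its convex hull). -/
def alphaStar {d n₀ : ℕ} (u : Fin n₀ → Vec d) (x : ℕ → Vec d) (N : ℕ) : Vec d :=
  Classical.epsilon fun α =>
    α ∈ admissible u x N ∧ IsMaxOn (logCapital u x N) (admissible u x N) α

/-- Capital after `N` rounds under the sequential optimizing strategy: in each round one bets the
proportion that was optimal for the preceding rounds. The initial capital is `1`. -/
def sosCapital {d n₀ : ℕ} (u : Fin n₀ → Vec d) (x : ℕ → Vec d) (N : ℕ) : ℝ :=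
  ∏ n ∈ Finset.range N, (1 + inner ℝ (alphaStar u x n) (x n))

/-- The quadratic variation matrix of the first `N` rounds. -/
def quadVar {d : ℕ} (x : ℕ → Vec d) (N : ℕ) : Matrix (Fin d) (Fin d) ℝ :=
  ∑ n ∈ Finset.range N, Matrix.vecMulVec (x n).ofLp (x n).ofLp

/-! ### The continuous-time game with limit orders -/

/-- The component-wise positive continuous price paths on `[0, ∞)`. -/
def pricePaths (d : ℕ) : Set (ℝ≥0 → Vec d) :=
  {S | Continuous S ∧ ∀ t j, 0 < S t j}

/-- The vector of returns of the assets from time `s` to time `t`. -/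
def returns {d : ℕ} (S : ℝ≥0 → Vec d) (s t : ℝ≥0) : Vec d :=
  WithLp.toLp 2 fun j => (S t j - S s j) / S s j

/-- The trading times: `t₀ = 0`, and `tᵢ₊₁` is the first time after `tᵢ` at which the vector of
returns since `tᵢ` has norm `δ` (it is `∞` if there is no such time). -/
def tradingTime {d : ℕ} (S : ℝ≥0 → Vec d) (δ : ℝ) : ℕ → ℝ≥0∞
  | 0 => 0
  | i + 1 => ⨅ (t : ℝ≥0) (_ : tradingTime S δ i < (t : ℝ≥0∞) ∧
      ‖returns S (tradingTime S δ i).toNNReal t‖ = δ), (t : ℝ≥0∞)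

/-- The moves of the embedded discrete-time game: the returns over `[tₙ, tₙ₊₁]`. -/
def move {d : ℕ} (S : ℝ≥0 → Vec d) (δ : ℝ) (n : ℕ) : Vec d :=
  returns S (tradingTime S δ n).toNNReal (tradingTime S δ (n + 1)).toNNReal

/-- The number `N` of completed rounds before `T`, characterized for a continuous path by
`t_N < T ≤ t_{N+1}` (when `0 < T` and `0 < δ`). -/
def numRounds {d : ℕ} (S : ℝ≥0 → Vec d) (δ : ℝ) (T : ℝ≥0) : ℕ :=
  sInf {n | (T : ℝ≥0∞) ≤ tradingTime S δ (n + 1)}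

/-- The optimal proportion `α*_N` computed from the training data `u` and all the moves completed
before `T`. -/
def finalAlpha {d n₀ : ℕ} (u : Fin n₀ → Vec d) (S : ℝ≥0 → Vec d) (δ : ℝ) (T : ℝ≥0) : Vec d :=
  alphaStar u (move S δ) (numRounds S δ T)

/-- Investor's capital at time `T` when he starts with capital `1`, trades at the times `tᵢ` and
chooses the proportions by the sequential optimizing strategy with training data `u`. The last
factor accounts for the open position held since the last trading time `t_N`. -/
def capital {d n₀ : ℕ} (u : Fin n₀ → Vec d) (S : ℝ≥0 → Vec d) (δ : ℝ) (T : ℝ≥0) : ℝ :=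
  sosCapital u (move S δ) (numRounds S δ T) *
    (1 + inner ℝ (finalAlpha u S δ T)
      (returns S (tradingTime S δ (numRounds S δ T)).toNNReal T))

/-! ### The classes of paths -/

/-- The paths for which some asset has log-price oscillation at most `A` on `[0, T]`. -/
def quietPaths (d : ℕ) (A : ℝ) (T : ℝ≥0) : Set (ℝ≥0 → Vec d) :=
  {S | S ∈ pricePaths d ∧ ∃ j, ∀ x y : ℝ≥0, x < y → y ≤ T →
    |Real.log (S x j) - Real.log (S y j)| ≤ A}

/-- The paths with `δ α*_N → 0` as `δ → 0+`, where `u δ` is the training data used at scale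
`δ`. -/
def smallBetPaths {d n₀ : ℕ} (u : ℝ → Fin n₀ → Vec d) (T : ℝ≥0) : Set (ℝ≥0 → Vec d) :=
  {S | S ∈ pricePaths d ∧
    Tendsto (fun δ : ℝ => δ • finalAlpha (u δ) S δ T) (𝓝[>] 0) (𝓝 0)}

/-- `tr V_N / δ ^ (2 - 1 / H)`, a nonnegative quantity for `δ > 0`, as an extended nonnegative
real. -/
def scaledVar {d : ℕ} (S : ℝ≥0 → Vec d) (H : ℝ) (T : ℝ≥0) (δ : ℝ) : ℝ≥0∞ :=
  ENNReal.ofReal ((quadVar (move S δ) (numRounds S δ T)).trace / δ ^ (2 - 1 / H))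

/-- The paths with Hölder exponent `H` on `[0, T]`. -/
def holderPaths (d : ℕ) (H : ℝ) (T : ℝ≥0) : Set (ℝ≥0 → Vec d) :=
  {S | S ∈ pricePaths d ∧ 0 < liminf (scaledVar S H T) (𝓝[>] 0) ∧
    limsup (scaledVar S H T) (𝓝[>] 0) < ⊤}

end TradingGame

end

open TradingGame

namespace TradingGame

/-! ### Elementary inequalities for the logarithm -/

/-! The log capital of the sequential strategy falls short of that of every admissible constant
proportion by at most O(log N). It therefore suffices to find, for each small δ, one constant
proportion whose log capital grows like a positive power of 1/δ.

Regret. Replacing the old leader α by a competitor β over one more round, a second order bound for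
log together with the first order condition at α leaves a single linear term, from the new move,
minus a quadratic form in β - α. The training data supply the identity part of that form at scale δ,
so completing the square bounds each round by an increment of log det(1 + δ⁻² V)
(`inner_sub_le_log_det`, `logCapital_succ_le`). The increments telescope to at most d log(d + N)
(`logCapital_le_log_sosCapital`). The open position costs only a factor ε₀, because its return has
norm at most δ.

Benchmarks. Every completed move has norm exactly δ, so tr V_N = N δ², and the Hölder condition says
that N is of order δ^(-1/H); hence log N = O(log(1/δ)). If H < 1/2, then N δ² diverges polynomially,
and holding one half in the asset with the largest quadratic variation gains a multiple of N δ²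
(`exists_logCapital_ge_quadVar`). If H > 1/2, then N δ² tends to 0, and a large bet, of order δ^(-(2
- 1/H)), on an asset with S(T) ≠ S(0) gains a multiple of its own size
(`exists_logCapital_ge_trend`). In both cases the gain beats the logarithmic regret. -/

lemma log_le_log_add_sub {B y z : ℝ} (hy : 0 < y) (hz : 0 < z) (hyB : y ≤ B) (hzB : z ≤ B) :
    Real.log y ≤ Real.log z + (y - z) / z - (y - z) ^ 2 / (4 * B ^ 2) := by
  -- With y = a² and z = b², log y - log z = 2 log(a/b) ≤ 2(a/b - 1), while (y - z)/z exceeds 2(a/b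
  -- - 1) by (a/b - 1)². That excess pays for the quadratic term.
  obtain ⟨a, ha, rfl⟩ : ∃ a : ℝ, 0 < a ∧ y = a ^ 2 :=
    ⟨√y, Real.sqrt_pos.2 hy, (Real.sq_sqrt hy.le).symm⟩
  obtain ⟨b, hb, rfl⟩ : ∃ b : ℝ, 0 < b ∧ z = b ^ 2 :=
    ⟨√z, Real.sqrt_pos.2 hz, (Real.sq_sqrt hz.le).symm⟩
  have hB : 0 < B := hy.trans_le hyB
  have h1 : Real.log (a / b) ≤ a / b - 1 := Real.log_le_sub_one_of_pos (by positivity)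
  rw [Real.log_div ha.ne' hb.ne'] at h1
  have h2 : (a ^ 2 - b ^ 2) ^ 2 / (4 * B ^ 2) ≤ (a / b - 1) ^ 2 := by
    have e : (a / b - 1) ^ 2 = (a - b) ^ 2 / b ^ 2 := by field_simp
    rw [e, div_le_div_iff₀ (by positivity) (by positivity)]
    have h3 : (a + b) ^ 2 ≤ 4 * B := by nlinarith [sq_nonneg (a - b)]
    have h4 : (a + b) ^ 2 * b ^ 2 ≤ 4 * B * B := by gcongr
    nlinarith [mul_le_mul_of_nonneg_left h4 (sq_nonneg (a - b))]
  have h5 : (a ^ 2 - b ^ 2) / b ^ 2 = (a / b - 1) ^ 2 + 2 * (a / b - 1) := by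
    field_simp; ring
  rw [Real.log_pow, Real.log_pow, h5]
  push_cast
  linarith

/-- Rebalancing premium: (1 + x)/(1 + x/2)² = 1 - (x²/4)/(1 + x/2)², and (1 + x/2)² ≤ 9/4 in this
range. -/
lemma half_log_add_sq_le_log {x : ℝ} (hx : |x| ≤ 1 / 2) :
    Real.log (1 + x) / 2 + x ^ 2 / 18 ≤ Real.log (1 + x / 2) := by
  obtain ⟨h1, h2⟩ := abs_le.1 hx
  have hx1 : 0 < 1 + x := by linarith
  have hx2 : 0 < 1 + x / 2 := by linarith
  have h3 := Real.log_le_sub_one_of_pos (x := (1 + x) / (1 + x / 2) ^ 2) (by positivity)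
  rw [Real.log_div hx1.ne' (by positivity), Real.log_pow] at h3
  have h4 : (1 + x) / (1 + x / 2) ^ 2 - 1 ≤ - (x ^ 2 / 9) := by
    rw [sub_le_iff_le_add, div_le_iff₀ (by positivity)]
    nlinarith [mul_nonneg (sq_nonneg x) (by nlinarith : (0 : ℝ) ≤ 9 / 4 - (1 + x / 2) ^ 2)]
  push_cast at h3
  linarith

lemma sub_two_mul_sq_le_log {x : ℝ} (hx : |x| ≤ 1 / 2) :
    x - 2 * x ^ 2 ≤ Real.log (1 + x) := by
  obtain ⟨h1, h2⟩ := abs_le.1 hx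
  have hx1 : 0 < 1 + x := by linarith
  refine le_trans ?_ (Real.one_sub_inv_le_log_of_pos hx1)
  rw [le_sub_iff_add_le, ← le_sub_iff_add_le', inv_le_iff_one_le_mul₀ hx1]
  nlinarith [mul_nonneg (sq_nonneg x) (by linarith : (0 : ℝ) ≤ 1 + 2 * x)]

lemma neg_one_le_log {y : ℝ} (hy : |y| ≤ 1 / 2) : -1 ≤ Real.log (1 + y) := by
  have h := sub_two_mul_sq_le_log hy
  obtain ⟨h1, h2⟩ := abs_le.1 hy
  nlinarith

lemma abs_log_le_two_mul {x δ : ℝ} (hx : |x| ≤ δ) (hδ : δ ≤ 1 / 2) :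
    |Real.log (1 + x)| ≤ 2 * δ := by
  have h := sub_two_mul_sq_le_log (hx.trans hδ)
  obtain ⟨h1, h2⟩ := abs_le.1 hx
  have h3 := Real.log_le_sub_one_of_pos (x := 1 + x) (by linarith)
  rw [abs_le]
  constructor <;> nlinarith

/-! ### The elliptical potential lemma -/

/-- Identity matrix plus the quadratic variation. -/
noncomputable def regVar {d : ℕ} (y : ℕ → Vec d) (n : ℕ) : Matrix (Fin d) (Fin d) ℝ :=
  1 + quadVar y n

section
open Matrix

variable {d : ℕ} (y : ℕ → Vec d)

lemma quadVar_succ (n : ℕ) :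
    quadVar y (n + 1) = quadVar y n + vecMulVec (y n).ofLp (y n).ofLp := by
  simp [quadVar, Finset.sum_range_succ]

lemma quadVar_posSemidef (n : ℕ) : (quadVar y n).PosSemidef := by
  induction n with
  | zero => simpa [quadVar] using Matrix.PosSemidef.zero
  | succ n ih =>
    rw [quadVar_succ]
    exact ih.add (by simpa using posSemidef_vecMulVec_self_star (y n).ofLp)

lemma regVar_posDef (n : ℕ) : (regVar y n).PosDef :=
  PosDef.one.add_posSemidef (quadVar_posSemidef y n)

lemma trace_quadVar (n : ℕ) :
    (quadVar y n).trace = ∑ k ∈ Finset.range n, ‖y k‖ ^ 2 := by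
  rw [quadVar, trace_sum]
  refine Finset.sum_congr rfl fun k _ => ?_
  rw [trace_vecMulVec, EuclideanSpace.real_norm_sq_eq]
  simp [dotProduct, sq]

lemma dotProduct_quadVar_mulVec (n : ℕ) (w : Vec d) :
    w.ofLp ⬝ᵥ (quadVar y n *ᵥ w.ofLp) = ∑ k ∈ Finset.range n, (inner ℝ w (y k)) ^ 2 := by
  rw [quadVar, sum_mulVec, dotProduct_sum]
  refine Finset.sum_congr rfl fun k _ => ?_
  rw [vecMulVec_mulVec, EuclideanSpace.inner_eq_star_dotProduct]
  simp [dotProduct_comm, sq]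

lemma dotProduct_regVar_mulVec (n : ℕ) (w : Vec d) :
    w.ofLp ⬝ᵥ (regVar y n *ᵥ w.ofLp)
      = ‖w‖ ^ 2 + ∑ k ∈ Finset.range n, (inner ℝ w (y k)) ^ 2 := by
  rw [regVar, add_mulVec, dotProduct_add, dotProduct_quadVar_mulVec, one_mulVec,
    EuclideanSpace.real_norm_sq_eq]
  simp [dotProduct, sq]

/-- Each eigenvalue is at most the trace, and vectors of norm at most 1 keep the trace below d + N.
-/
lemma log_det_regVar_le (N : ℕ) (hy : ∀ n < N, ‖y n‖ ≤ 1) :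
    Real.log (regVar y N).det ≤ d * Real.log (d + N) := by
  rcases Nat.eq_zero_or_pos d with rfl | hd
  · simp
  have hpd := regVar_posDef y N
  have htr : (regVar y N).trace ≤ d + N := by
    rw [regVar, trace_add, trace_quadVar, trace_one, Fintype.card_fin]
    gcongr
    calc _ ≤ ∑ k ∈ Finset.range N, (1 : ℝ) :=
          Finset.sum_le_sum fun k hk => pow_le_one₀ (norm_nonneg _) (hy k (Finset.mem_range.1 hk))
      _ = N := by simp
  have hev : ∀ i, hpd.isHermitian.eigenvalues i ≤ d + N := fun i => by
    refine le_trans ?_ htr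
    rw [hpd.isHermitian.trace_eq_sum_eigenvalues]
    simpa using Finset.single_le_sum (f := hpd.isHermitian.eigenvalues)
      (fun j _ => (hpd.eigenvalues_pos j).le) (Finset.mem_univ i)
  rw [← Real.log_pow]
  refine Real.log_le_log hpd.det_pos ?_
  rw [hpd.isHermitian.det_eq_prod_eigenvalues]
  calc _ ≤ ∏ _i : Fin d, ((d : ℝ) + N) :=
        Finset.prod_le_prod (fun i _ => (hpd.eigenvalues_pos i).le) fun i _ => by simpa using hev i
    _ = _ := by simp

/-- The increment of `log det` dominates the dual quadratic form of the new vector. -/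
lemma inner_sub_le_log_det {κ : ℝ} (hκ : 0 < κ) (p : ℝ) (n : ℕ) (w : Vec d) :
    p * inner ℝ w (y n)
        - κ * (‖w‖ ^ 2 + ∑ k ∈ Finset.range (n + 1), (inner ℝ w (y k)) ^ 2)
      ≤ p ^ 2 / (4 * κ) *
        (Real.log (regVar y (n + 1)).det - Real.log (regVar y n).det) := by
  set A := regVar y (n + 1) with hA
  have hpd : A.PosDef := regVar_posDef y (n + 1)
  have hpd' := regVar_posDef y n
  have hunit : IsUnit A.det := hpd.det_pos.ne'.isUnit
  set v := (y n).ofLp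
  set z := A⁻¹ *ᵥ v
  have hAz : A *ᵥ z = v := by
    simp only [z, mulVec_mulVec, mul_nonsing_inv A hunit, one_mulVec]
  have hsymm : ∀ a b : Fin d → ℝ, a ⬝ᵥ (A *ᵥ b) = b ⬝ᵥ (A *ᵥ a) := fun a b => by
    have hT : Aᵀ = A := by simpa [IsSymm] using hpd.isHermitian
    rw [dotProduct_mulVec, ← mulVec_transpose, hT, dotProduct_comm]
  have hinner : inner ℝ w (y n) = w.ofLp ⬝ᵥ v := by
    rw [EuclideanSpace.inner_eq_star_dotProduct]; simp [v, dotProduct_comm]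
  have hquad : p * inner ℝ w (y n)
      - κ * (‖w‖ ^ 2 + ∑ k ∈ Finset.range (n + 1), (inner ℝ w (y k)) ^ 2)
      ≤ p ^ 2 / (4 * κ) * (v ⬝ᵥ z) := by
    rw [← dotProduct_regVar_mulVec, hinner, ← hA]
    -- Completing the square in w: the maximizer of p⟨w, v⟩ - κ wᵀAw is (p/(2κ)) A⁻¹v.
    have h0 := hpd.posSemidef.dotProduct_mulVec_nonneg (w.ofLp - (p / (2 * κ)) • z)
    simp only [star_trivial, mulVec_sub, dotProduct_sub, sub_dotProduct, mulVec_smul,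
      dotProduct_smul, smul_dotProduct, smul_eq_mul, hsymm z w.ofLp, hAz] at h0
    rw [dotProduct_comm z v] at h0
    have h1 := mul_nonneg hκ.le h0
    have h2 : κ * (w.ofLp ⬝ᵥ A *ᵥ w.ofLp - p / (2 * κ) * (w.ofLp ⬝ᵥ v)
        - (p / (2 * κ) * (w.ofLp ⬝ᵥ v) - p / (2 * κ) * (p / (2 * κ) * (v ⬝ᵥ z))))
        = κ * (w.ofLp ⬝ᵥ A *ᵥ w.ofLp) - p * (w.ofLp ⬝ᵥ v) + p ^ 2 / (4 * κ) * (v ⬝ᵥ z) := by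
      field_simp; ring
    linarith
  refine hquad.trans (mul_le_mul_of_nonneg_left ?_ (by positivity))
  -- The rank-one determinant formula turns vᵀA⁻¹v into one minus a ratio of determinants, to which
  -- log r ≤ r - 1 applies.
  have hdet : (regVar y n).det = A.det * (1 - v ⬝ᵥ z) := by
    have h1 : regVar y n = A * (1 + replicateCol Unit (-z) * replicateRow Unit v) := by
      rw [← vecMulVec_eq, mul_add, mul_one, mul_vecMulVec, mulVec_neg, hAz, neg_vecMulVec, hA,
        regVar, regVar, quadVar_succ]
      abel
    rw [h1, det_mul, det_one_add_replicateCol_mul_replicateRow, dotProduct_neg, ← sub_eq_add_neg]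
  have hlog := Real.log_le_sub_one_of_pos (x := (regVar y n).det / A.det)
    (div_pos hpd'.det_pos hpd.det_pos)
  rw [Real.log_div hpd'.det_pos.ne' hpd.det_pos.ne', hdet, mul_div_cancel_left₀ _ hpd.det_pos.ne',
    ← hdet] at hlog
  linarith

end

/-! ### The hindsight optimal proportion -/

section

variable {d n₀ : ℕ} {ε₀ δ : ℝ} {u : Fin n₀ → Vec d} {x : ℕ → Vec d} {N : ℕ}

/-- The move of norm δ opposite to α is the worst one, and its factor is 1 - ‖α‖δ. -/
lemma IsTrainingData.norm_mul_le (hε₀ : ε₀ ∈ Ioo (0 : ℝ) 1) (hδ : 0 < δ)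
    (hu : IsTrainingData ε₀ (Metric.sphere (0 : Vec d) δ) u) {α : Vec d}
    (hα : ∀ i, 0 ≤ 1 + inner ℝ α (u i)) : ‖α‖ * δ ≤ 1 - ε₀ := by
  rcases eq_or_ne α 0 with rfl | h0
  · simpa using hε₀.2.le
  have hn : 0 < ‖α‖ := norm_pos_iff.2 h0
  have h := hu α hα (-(δ / ‖α‖) • α) (by
    rw [mem_sphere_zero_iff_norm, norm_smul, norm_neg, Real.norm_of_nonneg (by positivity)]
    field_simp)
  rw [inner_smul_right, real_inner_self_eq_norm_sq] at h
  have e : -(δ / ‖α‖) * ‖α‖ ^ 2 = -(‖α‖ * δ) := by field_simp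
  linarith

lemma IsTrainingData.le_one_add_inner (hε₀ : ε₀ ∈ Ioo (0 : ℝ) 1) (hδ : 0 < δ)
    (hu : IsTrainingData ε₀ (Metric.sphere (0 : Vec d) δ) u) {α : Vec d}
    (hα : ∀ i, 0 ≤ 1 + inner ℝ α (u i)) {y : Vec d} (hy : ‖y‖ ≤ δ) :
    ε₀ ≤ 1 + inner ℝ α y := by
  have h1 := hu.norm_mul_le hε₀ hδ hα
  have h2 := (abs_le.1 (abs_real_inner_le_norm α y)).1
  have h3 := mul_le_mul_of_nonneg_left hy (norm_nonneg α)
  linarith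

lemma IsTrainingData.one_add_inner_le_two (hε₀ : ε₀ ∈ Ioo (0 : ℝ) 1) (hδ : 0 < δ)
    (hu : IsTrainingData ε₀ (Metric.sphere (0 : Vec d) δ) u) {α : Vec d}
    (hα : ∀ i, 0 ≤ 1 + inner ℝ α (u i)) {y : Vec d} (hy : ‖y‖ ≤ δ) :
    1 + inner ℝ α y ≤ 2 := by
  have h1 := hu.norm_mul_le hε₀ hδ hα
  have h2 := real_inner_le_norm α y
  have h3 := mul_le_mul_of_nonneg_left hy (norm_nonneg α)
  linarith [hε₀.1]

lemma IsTrainingData.one_add_inner_training_le (hε₀ : ε₀ ∈ Ioo (0 : ℝ) 1) (hδ : 0 < δ)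
    (hu : IsTrainingData ε₀ (Metric.sphere (0 : Vec d) δ) u) {M : ℝ} (hM : 0 ≤ M) {α : Vec d}
    (hα : ∀ i, 0 ≤ 1 + inner ℝ α (u i)) {i : Fin n₀} (hi : ‖u i‖ ≤ M * δ) :
    1 + inner ℝ α (u i) ≤ 1 + M := by
  have h1 := hu.norm_mul_le hε₀ hδ hα
  have h2 := real_inner_le_norm α (u i)
  have h3 := mul_le_mul_of_nonneg_left hi (norm_nonneg α)
  nlinarith [hε₀.1]

/-- The training data control the norm of every direction at scale `δ`. -/
lemma IsTrainingData.sq_norm_le_sum (hε₀ : ε₀ ∈ Ioo (0 : ℝ) 1) (hδ : 0 < δ)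
    (hu : IsTrainingData ε₀ (Metric.sphere (0 : Vec d) δ) u) (w : Vec d) :
    (‖w‖ * δ) ^ 2 ≤ ∑ i, (inner ℝ w (u i)) ^ 2 := by
  by_contra! hlt
  have hpos : 0 < ‖w‖ * δ := by
    rcases (mul_nonneg (norm_nonneg w) hδ.le).lt_or_eq with h | h
    · exact h
    · rw [← h] at hlt
      exact absurd hlt (not_lt.2 (by simpa using Finset.sum_nonneg fun i _ => sq_nonneg _))
  -- If the bound failed, w rescaled to norm 1/δ would keep all training factors nonnegative,
  -- although such proportions satisfy ‖α‖δ ≤ 1 - ε₀ < 1.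
  have h1 := hu.norm_mul_le hε₀ hδ (α := (‖w‖ * δ)⁻¹ • w) fun i => by
    have h2 : |inner ℝ w (u i)| ≤ ‖w‖ * δ := by
      refine abs_le_of_sq_le_sq ?_ hpos.le
      exact (Finset.single_le_sum (f := fun i => (inner ℝ w (u i)) ^ 2)
        (fun j _ => sq_nonneg _) (Finset.mem_univ i)).trans hlt.le
    rw [real_inner_smul_left]
    have h3 : -1 ≤ (‖w‖ * δ)⁻¹ * inner ℝ w (u i) := by
      rw [inv_mul_eq_div, le_div_iff₀ hpos]
      linarith [(abs_le.1 h2).1]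
    linarith
  rw [norm_smul, Real.norm_of_nonneg (by positivity), mul_assoc, inv_mul_cancel₀ hpos.ne'] at h1
  linarith [hε₀.1]

lemma mem_admissible_iff (hε₀ : ε₀ ∈ Ioo (0 : ℝ) 1) (hδ : 0 < δ)
    (hu : IsTrainingData ε₀ (Metric.sphere (0 : Vec d) δ) u) (hx : ∀ n < N, ‖x n‖ ≤ δ)
    {α : Vec d} : α ∈ admissible u x N ↔ ∀ i, 0 < 1 + inner ℝ α (u i) :=
  ⟨fun h => h.1, fun h => ⟨h, fun n hn =>
    hε₀.1.trans_le (hu.le_one_add_inner hε₀ hδ (fun i => (h i).le) (hx n hn))⟩⟩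

lemma logCapital_eq_log (α : Vec d) (hα : α ∈ admissible u x N) :
    logCapital u x N α = Real.log ((∏ i, (1 + inner ℝ α (u i))) *
      ∏ n ∈ Finset.range N, (1 + inner ℝ α (x n))) := by
  rw [logCapital, Real.log_mul, Real.log_prod, Real.log_prod]
  · exact fun n hn => (hα.2 n (Finset.mem_range.1 hn)).ne'
  · exact fun i _ => (hα.1 i).ne'
  · exact Finset.prod_ne_zero_iff.2 fun i _ => (hα.1 i).ne'
  · exact Finset.prod_ne_zero_iff.2 fun n hn => (hα.2 n (Finset.mem_range.1 hn)).ne'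

/-- The training constraints cut out a compact set, on which the product of all factors, unlike its
logarithm, is continuous up to the boundary. Its maximum is at least 1, the value at the origin, so
no training factor vanishes there; move factors are at least ε₀ automatically. -/
lemma alphaStar_spec (hε₀ : ε₀ ∈ Ioo (0 : ℝ) 1) (hδ : 0 < δ)
    (hu : IsTrainingData ε₀ (Metric.sphere (0 : Vec d) δ) u) (hx : ∀ n < N, ‖x n‖ ≤ δ) :
    alphaStar u x N ∈ admissible u x N ∧
      IsMaxOn (logCapital u x N) (admissible u x N) (alphaStar u x N) := by
  refine Classical.epsilon_spec (p := fun α => α ∈ admissible u x N ∧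
    IsMaxOn (logCapital u x N) (admissible u x N) α) ?_
  set K : Set (Vec d) := {α | ∀ i, 0 ≤ 1 + inner ℝ α (u i)} with hK
  have hKc : IsCompact K := by
    refine (isCompact_closedBall (0 : Vec d) ((1 - ε₀) / δ)).of_isClosed_subset ?_ fun α hα => ?_
    · rw [show K = ⋂ i, {α | 0 ≤ 1 + inner ℝ α (u i)} by ext α; simp [hK]]
      exact isClosed_iInter fun i => isClosed_le continuous_const (by fun_prop)
    · rw [mem_closedBall_zero_iff, le_div_iff₀ hδ]
      exact hu.norm_mul_le hε₀ hδ hα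
  set f : Vec d → ℝ := fun α => (∏ i, (1 + inner ℝ α (u i))) *
      ∏ n ∈ Finset.range N, (1 + inner ℝ α (x n)) with hf
  have h0K : (0 : Vec d) ∈ K := fun i => by simp
  obtain ⟨α, hαK, hα⟩ := hKc.exists_isMaxOn ⟨0, h0K⟩ (f := f) (by fun_prop)
  have hfα : 1 ≤ f α := by simpa [hf] using hα h0K
  have hadm : α ∈ admissible u x N := by
    refine (mem_admissible_iff hε₀ hδ hu hx).2 fun i => (hαK i).lt_of_ne fun h => ?_
    have : f α = 0 := by
      simp only [hf]
      rw [Finset.prod_eq_zero (Finset.mem_univ i) h.symm, zero_mul]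
    linarith
  refine ⟨α, hadm, fun β hβ => ?_⟩
  change logCapital u x N β ≤ logCapital u x N α
  rw [logCapital_eq_log β hβ, logCapital_eq_log α hadm]
  refine Real.log_le_log (mul_pos (Finset.prod_pos fun i _ => hβ.1 i)
    (Finset.prod_pos fun n hn => hβ.2 n (Finset.mem_range.1 hn))) (hα fun i => (hβ.1 i).le)

/-- The first order condition at the hindsight optimal proportion. -/
lemma sum_inner_div_eq_zero {α : Vec d} (hα : α ∈ admissible u x N)
    (hmax : IsMaxOn (logCapital u x N) (admissible u x N) α) (w : Vec d) :
    ∑ i, inner ℝ w (u i) / (1 + inner ℝ α (u i)) +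
      ∑ n ∈ Finset.range N, inner ℝ w (x n) / (1 + inner ℝ α (x n)) = 0 := by
  have hline : Continuous fun t : ℝ => α + t • w := by fun_prop
  have hopen : IsOpen (admissible u x N) := by
    have : admissible u x N = (⋂ i, {α | 0 < 1 + inner ℝ α (u i)}) ∩
        ⋂ n ∈ Finset.range N, {α | 0 < 1 + inner ℝ α (x n)} := by
      ext β; simp [admissible]
    rw [this]
    refine IsOpen.inter (isOpen_iInter_of_finite fun i => isOpen_lt continuous_const (by fun_prop))
      (isOpen_biInter_finset fun n _ => isOpen_lt continuous_const (by fun_prop))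
  have hloc : IsLocalMax (fun t : ℝ => logCapital u x N (α + t • w)) 0 := by
    have h := hline.tendsto 0
    rw [zero_smul, add_zero] at h
    filter_upwards [h (hopen.mem_nhds hα)] with t ht
    simpa using hmax ht
  have hd : ∀ v : Vec d, 0 < 1 + inner ℝ α v →
      HasDerivAt (fun t : ℝ => Real.log (1 + inner ℝ (α + t • w) v))
        (inner ℝ w v / (1 + inner ℝ α v)) 0 := fun v hv => by
    have h1 : HasDerivAt (fun t : ℝ => 1 + inner ℝ (α + t • w) v) (inner ℝ w v) 0 := by
      simp only [inner_add_left, real_inner_smul_left]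
      simpa using (((hasDerivAt_id (0 : ℝ)).mul_const (inner ℝ w v)).const_add
        (inner ℝ α v)).const_add 1
    simpa using h1.log (by simpa using hv.ne')
  refine hloc.hasDerivAt_eq_zero ?_
  unfold logCapital
  exact (HasDerivAt.fun_sum fun i _ => hd (u i) (hα.1 i)).add
    (HasDerivAt.fun_sum fun n hn => hd (x n) (hα.2 n (Finset.mem_range.1 hn)))

lemma sosCapital_succ : sosCapital u x (N + 1)
    = sosCapital u x N * (1 + inner ℝ (alphaStar u x N) (x N)) := by
  rw [sosCapital, sosCapital, Finset.prod_range_succ]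

lemma sosCapital_pos (hε₀ : ε₀ ∈ Ioo (0 : ℝ) 1) (hδ : 0 < δ)
    (hu : IsTrainingData ε₀ (Metric.sphere (0 : Vec d) δ) u) (hx : ∀ n < N, ‖x n‖ ≤ δ) :
    0 < sosCapital u x N := by
  refine Finset.prod_pos fun n hn => ?_
  have hn := Finset.mem_range.1 hn
  have h := (alphaStar_spec hε₀ hδ hu fun k hk => hx k (hk.trans hn)).1
  exact hε₀.1.trans_le (hu.le_one_add_inner hε₀ hδ (fun i => (h.1 i).le) (hx n hn))

/-- One round of regret. -/
lemma logCapital_succ_le (hε₀ : ε₀ ∈ Ioo (0 : ℝ) 1) (hδ : 0 < δ)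
    (hu : IsTrainingData ε₀ (Metric.sphere (0 : Vec d) δ) u) {M : ℝ} (hM : 0 ≤ M)
    (huM : ∀ i, ‖u i‖ ≤ M * δ) (hx : ∀ n < N + 1, ‖x n‖ ≤ δ) {β : Vec d}
    (hβ : β ∈ admissible u x (N + 1)) :
    logCapital u x (N + 1) β ≤ logCapital u x N (alphaStar u x N)
      + Real.log (1 + inner ℝ (alphaStar u x N) (x N))
      + ((2 + M) / ε₀) ^ 2 * (Real.log (regVar (fun n => δ⁻¹ • x n) (N + 1)).det
          - Real.log (regVar (fun n => δ⁻¹ • x n) N).det) := by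
  obtain ⟨hα, hmax⟩ := alphaStar_spec (N := N) hε₀ hδ hu fun n hn => hx n (by omega)
  set α := alphaStar u x N
  have hα0 : ∀ i, 0 ≤ 1 + inner ℝ α (u i) := fun i => (hα.1 i).le
  have hβ0 : ∀ i, 0 ≤ 1 + inner ℝ β (u i) := fun i => (hβ.1 i).le
  set w := β - α with hw
  have hfoc := sum_inner_div_eq_zero hα hmax w
  -- This is the curvature 1/(4B²) of `log_le_log_add_sub` with B = 2 + M, which bounds training
  -- factors (≤ 1 + M) and move factors (≤ 2) alike.
  set κ : ℝ := 1 / (4 * (2 + M) ^ 2) with hκ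
  have hκ0 : 0 < κ := by positivity
  have hstep : ∀ v : Vec d, 0 < 1 + inner ℝ α v → 0 < 1 + inner ℝ β v →
      1 + inner ℝ α v ≤ 2 + M → 1 + inner ℝ β v ≤ 2 + M →
      Real.log (1 + inner ℝ β v) ≤ Real.log (1 + inner ℝ α v)
        + inner ℝ w v / (1 + inner ℝ α v) - κ * inner ℝ w v ^ 2 := fun v h1 h2 h3 h4 => by
    have h := log_le_log_add_sub h2 h1 h4 h3
    have e : 1 + inner ℝ β v - (1 + inner ℝ α v) = inner ℝ w v := by
      rw [hw, inner_sub_left]; ring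
    rw [e] at h
    rw [hκ, one_div_mul_eq_div]
    exact h
  have hsu : ∑ i, Real.log (1 + inner ℝ β (u i)) ≤ ∑ i, Real.log (1 + inner ℝ α (u i))
      + ∑ i, inner ℝ w (u i) / (1 + inner ℝ α (u i)) - κ * ∑ i, inner ℝ w (u i) ^ 2 := by
    rw [Finset.mul_sum, ← Finset.sum_add_distrib, ← Finset.sum_sub_distrib]
    refine Finset.sum_le_sum fun i _ => hstep _ (hα.1 i) (hβ.1 i) ?_ ?_
    · linarith [hu.one_add_inner_training_le hε₀ hδ hM hα0 (huM i)]
    · linarith [hu.one_add_inner_training_le hε₀ hδ hM hβ0 (huM i)]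
  have hstepx : ∀ n < N + 1, Real.log (1 + inner ℝ β (x n)) ≤ Real.log (1 + inner ℝ α (x n))
        + inner ℝ w (x n) / (1 + inner ℝ α (x n)) - κ * inner ℝ w (x n) ^ 2 := fun n hn => by
    refine hstep _ ?_ (hβ.2 n hn) ?_ ?_
    · exact hε₀.1.trans_le (hu.le_one_add_inner hε₀ hδ hα0 (hx n hn))
    · linarith [hu.one_add_inner_le_two hε₀ hδ hα0 (hx n hn)]
    · linarith [hu.one_add_inner_le_two hε₀ hδ hβ0 (hx n hn)]
  have hsx : ∑ n ∈ Finset.range (N + 1), Real.log (1 + inner ℝ β (x n))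
      ≤ ∑ n ∈ Finset.range (N + 1), Real.log (1 + inner ℝ α (x n))
      + ∑ n ∈ Finset.range (N + 1), inner ℝ w (x n) / (1 + inner ℝ α (x n))
      - κ * ∑ n ∈ Finset.range (N + 1), inner ℝ w (x n) ^ 2 := by
    rw [Finset.mul_sum, ← Finset.sum_add_distrib, ← Finset.sum_sub_distrib]
    exact Finset.sum_le_sum fun n hn => hstepx n (Finset.mem_range.1 hn)
  -- Moves are scaled by 1/δ to norm at most 1 and w by δ, which leaves the inner products
  -- unchanged.
  have hell := inner_sub_le_log_det (fun n => δ⁻¹ • x n) hκ0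
    (1 + inner ℝ α (x N))⁻¹ N (δ • w)
  have hsc : ∀ n, inner ℝ (δ • w) (δ⁻¹ • x n) = inner ℝ w (x n) := fun n => by
    rw [real_inner_smul_left, inner_smul_right, mul_inv_cancel_left₀ hδ.ne']
  simp only [hsc] at hell
  have hnorm : ‖δ • w‖ ^ 2 ≤ ∑ i, inner ℝ w (u i) ^ 2 := by
    rw [norm_smul, Real.norm_of_nonneg hδ.le, mul_comm]
    exact hu.sq_norm_le_sum hε₀ hδ w
  set D := Real.log (regVar (fun n => δ⁻¹ • x n) (N + 1)).det
          - Real.log (regVar (fun n => δ⁻¹ • x n) N).det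
  have hD : 0 ≤ D := by
    have := inner_sub_le_log_det (fun n => δ⁻¹ • x n) (κ := 1 / 4) (by norm_num) 1 N 0
    exact sub_nonneg.2 (by simpa using this)
  have hcoef : (1 + inner ℝ α (x N))⁻¹ ^ 2 / (4 * κ) ≤ ((2 + M) / ε₀) ^ 2 := by
    have h1 : (1 + inner ℝ α (x N))⁻¹ ≤ ε₀⁻¹ :=
      inv_anti₀ hε₀.1 (hu.le_one_add_inner hε₀ hδ hα0 (hx N (by omega)))
    have h2 : 0 ≤ (1 + inner ℝ α (x N))⁻¹ := inv_nonneg.2 <|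
      hε₀.1.le.trans (hu.le_one_add_inner hε₀ hδ hα0 (hx N (by omega)))
    have e : (1 + inner ℝ α (x N))⁻¹ ^ 2 / (4 * κ)
        = (1 + inner ℝ α (x N))⁻¹ ^ 2 * (2 + M) ^ 2 := by
      rw [hκ]; field_simp
    rw [e, div_eq_mul_inv, mul_pow, mul_comm]
    gcongr
  have hcD := mul_le_mul_of_nonneg_right hcoef hD
  have hκn := mul_le_mul_of_nonneg_left hnorm hκ0.le
  rw [Finset.sum_range_succ (fun n => Real.log (1 + inner ℝ α (x n))),
    Finset.sum_range_succ (fun n => inner ℝ w (x n) / (1 + inner ℝ α (x n)))] at hsx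
  rw [mul_add] at hell
  rw [logCapital, logCapital]
  rw [div_eq_inv_mul (inner ℝ w (x N))] at hsx
  linarith

/-- Logarithmic regret of the sequential optimizing strategy. -/
lemma logCapital_le_log_sosCapital (hε₀ : ε₀ ∈ Ioo (0 : ℝ) 1) (hδ : 0 < δ)
    (hu : IsTrainingData ε₀ (Metric.sphere (0 : Vec d) δ) u) {M : ℝ} (hM : 0 ≤ M)
    (huM : ∀ i, ‖u i‖ ≤ M * δ) (hx : ∀ n < N, ‖x n‖ ≤ δ) {β : Vec d}
    (hβ : β ∈ admissible u x N) :
    logCapital u x N β ≤ Real.log (sosCapital u x N) + n₀ * Real.log (1 + M)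
      + ((2 + M) / ε₀) ^ 2 * (d * Real.log (d + N)) := by
  -- The competitor stays quantified so that the induction hypothesis can be applied to the leader
  -- of the preceding rounds.
  have key : ∀ n ≤ N, ∀ β ∈ admissible u x n, logCapital u x n β ≤
      Real.log (sosCapital u x n) + n₀ * Real.log (1 + M)
      + ((2 + M) / ε₀) ^ 2 * Real.log (regVar (fun n => δ⁻¹ • x n) n).det := by
    intro n
    induction n with
    | zero =>
      intro _ β hβ
      have h : ∑ i, Real.log (1 + inner ℝ β (u i)) ≤ ∑ _i : Fin n₀, Real.log (1 + M) :=
        Finset.sum_le_sum fun i _ => Real.log_le_log (hβ.1 i)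
          (hu.one_add_inner_training_le hε₀ hδ hM (fun i => (hβ.1 i).le) (huM i))
      simpa [logCapital, sosCapital, regVar, quadVar] using h
    | succ n ih =>
      intro hn β hβ
      have hxn : ∀ k < n, ‖x k‖ ≤ δ := fun k hk => hx k (by omega)
      have hα := (alphaStar_spec hε₀ hδ hu hxn).1
      have h1 := ih (by omega) _ hα
      have h2 := logCapital_succ_le hε₀ hδ hu hM huM (fun k hk => hx k (by omega)) hβ
      have hpos : 0 < 1 + inner ℝ (alphaStar u x n) (x n) := hε₀.1.trans_le
        (hu.le_one_add_inner hε₀ hδ (fun i => (hα.1 i).le) (hx n (by omega)))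
      rw [sosCapital_succ, Real.log_mul (sosCapital_pos hε₀ hδ hu hxn).ne' hpos.ne']
      linarith
  refine (key N le_rfl β hβ).trans ?_
  gcongr
  refine log_det_regVar_le _ N fun n hn => ?_
  rw [norm_smul, norm_inv, Real.norm_of_nonneg hδ.le, inv_mul_le_iff₀ hδ, mul_one]
  exact hx n hn

end

/-! ### Trading times -/

section

variable {d : ℕ} {S : ℝ≥0 → Vec d} {δ : ℝ}

@[simp]
lemma returns_self (s : ℝ≥0) : returns S s s = 0 := by
  ext j; simp [returns]

lemma continuous_returns (hS : S ∈ pricePaths d) :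
    Continuous fun p : ℝ≥0 × ℝ≥0 => returns S p.1 p.2 := by
  have hc : ∀ j, Continuous fun t => S t j := fun j => by
    have := hS.1
    fun_prop
  refine (PiLp.continuous_toLp 2 _).comp (continuous_pi fun j => ?_)
  exact (((hc j).comp continuous_snd).sub ((hc j).comp continuous_fst)).div
    ((hc j).comp continuous_fst) fun p => (hS.2 _ _).ne'

lemma continuous_norm_returns (hS : S ∈ pricePaths d) (s : ℝ≥0) :
    Continuous fun t => ‖returns S s t‖ :=
  ((continuous_returns hS).comp (Continuous.prodMk_right s)).norm

lemma one_add_returns (hS : S ∈ pricePaths d) (s t : ℝ≥0) (j : Fin d) :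
    1 + returns S s t j = S t j / S s j := by
  have := (hS.2 s j).ne'
  simp only [returns]
  field_simp
  ring

/-- The times after `s` at which the return since `s` has norm `δ`. -/
def hittingTimes (S : ℝ≥0 → Vec d) (δ : ℝ) (s : ℝ≥0) : Set ℝ≥0 :=
  {t | s < t ∧ ‖returns S s t‖ = δ}

/-- The strict inequality s < t does no harm, since the return at t = s is 0 ≠ δ. Closedness makes
the infimum in `tradingTime` attained. -/
lemma isClosed_hittingTimes (hS : S ∈ pricePaths d) (hδ : 0 < δ) (s : ℝ≥0) :
    IsClosed (hittingTimes S δ s) := by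
  have h : hittingTimes S δ s = Ici s ∩ {t | ‖returns S s t‖ = δ} := by
    ext t
    simp only [hittingTimes, mem_inter_iff, mem_Ici]
    refine ⟨fun h => ⟨h.1.le, h.2⟩, fun h => ⟨h.1.lt_of_ne ?_, h.2⟩⟩
    rintro rfl
    have := h.2
    simp at this
    exact hδ.ne this
  rw [h]
  exact isClosed_Ici.inter (isClosed_eq (continuous_norm_returns hS s) continuous_const)

lemma tradingTime_succ (i : ℕ) (hi : tradingTime S δ i ≠ ⊤) :
    tradingTime S δ (i + 1)
      = ⨅ t ∈ hittingTimes S δ (tradingTime S δ i).toNNReal, (t : ℝ≥0∞) := by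
  rw [tradingTime]
  refine iInf_congr fun t => iInf_congr_Prop ?_ fun _ => rfl
  conv_lhs => rw [← ENNReal.coe_toNNReal hi]
  simp [hittingTimes]

lemma tradingTime_succ_eq_top (i : ℕ) (hi : tradingTime S δ i = ⊤) :
    tradingTime S δ (i + 1) = ⊤ := by
  rw [tradingTime]
  simp [hi]

lemma toNNReal_tradingTime_succ_mem (hS : S ∈ pricePaths d) (hδ : 0 < δ) (i : ℕ)
    (hi : tradingTime S δ (i + 1) ≠ ⊤) :
    (tradingTime S δ (i + 1)).toNNReal ∈ hittingTimes S δ (tradingTime S δ i).toNNReal := by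
  have hi' : tradingTime S δ i ≠ ⊤ := fun h => hi (tradingTime_succ_eq_top i h)
  rw [tradingTime_succ i hi'] at hi ⊢
  set Z := hittingTimes S δ (tradingTime S δ i).toNNReal
  have hne : Z.Nonempty := by
    by_contra h
    rw [not_nonempty_iff_eq_empty] at h
    simp [h] at hi
  rw [← ENNReal.coe_sInf hne, ENNReal.toNNReal_coe]
  exact (isClosed_hittingTimes hS hδ _).csInf_mem hne (OrderBot.bddBelow _)

/-- A larger return would, by the intermediate value theorem, force an earlier hitting time. -/
lemma norm_returns_le (hS : S ∈ pricePaths d) (hδ : 0 < δ) (i : ℕ)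
    (hi : tradingTime S δ i ≠ ⊤) {t : ℝ≥0} (h1 : (tradingTime S δ i).toNNReal ≤ t)
    (h2 : (t : ℝ≥0∞) ≤ tradingTime S δ (i + 1)) :
    ‖returns S (tradingTime S δ i).toNNReal t‖ ≤ δ := by
  by_contra! hlt
  set s := (tradingTime S δ i).toNNReal
  obtain ⟨t', ht', he⟩ := intermediate_value_Ioo h1 (continuous_norm_returns hS s).continuousOn
    (show δ ∈ Ioo ‖returns S s s‖ ‖returns S s t‖ from ⟨by simpa using hδ, hlt⟩)
  have h3 : tradingTime S δ (i + 1) ≤ t' := by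
    rw [tradingTime_succ i hi]
    exact iInf₂_le t' ⟨ht'.1, he⟩
  exact absurd (ENNReal.coe_le_coe.1 (h2.trans h3)) (not_le.2 ht'.2)

lemma norm_move (hS : S ∈ pricePaths d) (hδ : 0 < δ) (i : ℕ)
    (hi : tradingTime S δ (i + 1) ≠ ⊤) : ‖move S δ i‖ = δ :=
  (toNNReal_tradingTime_succ_mem hS hδ i hi).2

/-- Infinitely many trading times before T would converge, and joint continuity would send the
consecutive returns, all of norm δ, to 0. -/
lemma exists_le_tradingTime (hS : S ∈ pricePaths d) (hδ : 0 < δ) (T : ℝ≥0) :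
    ∃ n, (T : ℝ≥0∞) ≤ tradingTime S δ (n + 1) := by
  by_contra! hlt
  have hfin : ∀ n, tradingTime S δ (n + 1) ≠ ⊤ := fun n => ((hlt n).trans ENNReal.coe_lt_top).ne
  set τ : ℕ → ℝ≥0 := fun n => (tradingTime S δ n).toNNReal with hτ
  have hmono : Monotone τ :=
    monotone_nat_of_le_succ fun n => (toNNReal_tradingTime_succ_mem hS hδ n (hfin n)).1.le
  have hbdd : BddAbove (range τ) := by
    refine ⟨T, ?_⟩
    rintro _ ⟨n, rfl⟩
    refine (hmono n.le_succ).trans ?_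
    rw [← ENNReal.coe_le_coe, hτ, ENNReal.coe_toNNReal (hfin n)]
    exact (hlt n).le
  have hlim := tendsto_atTop_ciSup hmono hbdd
  have h := (((continuous_returns hS).tendsto (_, _)).comp
    (hlim.prodMk_nhds ((tendsto_add_atTop_iff_nat 1).2 hlim))).norm
  simp only [returns_self, norm_zero] at h
  have hconst : Tendsto (fun _ : ℕ => δ) atTop (𝓝 0) := by
    refine h.congr fun n => norm_move hS hδ n (hfin n)
  exact hδ.ne' (tendsto_nhds_unique tendsto_const_nhds hconst)

lemma le_tradingTime_numRounds_succ (hS : S ∈ pricePaths d) (hδ : 0 < δ) (T : ℝ≥0) :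
    (T : ℝ≥0∞) ≤ tradingTime S δ (numRounds S δ T + 1) :=
  Nat.sInf_mem (s := {n | (T : ℝ≥0∞) ≤ tradingTime S δ (n + 1)}) (exists_le_tradingTime hS hδ T)

lemma tradingTime_succ_lt (S : ℝ≥0 → Vec d) (δ : ℝ) (T : ℝ≥0) {n : ℕ}
    (hn : n < numRounds S δ T) : tradingTime S δ (n + 1) < T :=
  not_le.1 (Nat.notMem_of_lt_sInf (s := {n | (T : ℝ≥0∞) ≤ tradingTime S δ (n + 1)}) hn)

lemma tradingTime_numRounds_le (S : ℝ≥0 → Vec d) (δ : ℝ) (T : ℝ≥0) :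
    tradingTime S δ (numRounds S δ T) ≤ T := by
  rcases h : numRounds S δ T with _ | n
  · simp [tradingTime]
  · exact (tradingTime_succ_lt S δ T (by omega)).le

lemma norm_move_of_lt (hS : S ∈ pricePaths d) (hδ : 0 < δ) (T : ℝ≥0) {n : ℕ}
    (hn : n < numRounds S δ T) : ‖move S δ n‖ = δ :=
  norm_move hS hδ n ((tradingTime_succ_lt S δ T hn).trans ENNReal.coe_lt_top).ne

/-- The return of the open position. -/
lemma norm_returns_last_le (hS : S ∈ pricePaths d) (hδ : 0 < δ) (T : ℝ≥0) :
    ‖returns S (tradingTime S δ (numRounds S δ T)).toNNReal T‖ ≤ δ := by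
  have hle := tradingTime_numRounds_le S δ T
  refine norm_returns_le hS hδ _ (hle.trans_lt ENNReal.coe_lt_top).ne ?_
    (le_tradingTime_numRounds_succ hS hδ T)
  exact ENNReal.toNNReal_mono ENNReal.coe_ne_top hle

lemma sum_log_one_add_move (hS : S ∈ pricePaths d) (N : ℕ) (j : Fin d) :
    ∑ n ∈ Finset.range N, Real.log (1 + move S δ n j)
      = Real.log (S (tradingTime S δ N).toNNReal j) - Real.log (S 0 j) := by
  have h : ∀ n, Real.log (1 + move S δ n j)
      = Real.log (S (tradingTime S δ (n + 1)).toNNReal j)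
        - Real.log (S (tradingTime S δ n).toNNReal j) := fun n => by
    rw [move, one_add_returns hS, Real.log_div (hS.2 _ _).ne' (hS.2 _ _).ne']
  rw [Finset.sum_congr rfl fun n _ => h n,
    Finset.sum_range_sub fun n => Real.log (S (tradingTime S δ n).toNNReal j)]
  simp [tradingTime]

/-- The log returns telescope; only the open interval from t_N to T is missing. -/
lemma abs_sum_log_sub_le (hS : S ∈ pricePaths d) (hδ : 0 < δ) (hδ' : δ ≤ 1 / 2) (T : ℝ≥0)
    (j : Fin d) :
    |∑ n ∈ Finset.range (numRounds S δ T), Real.log (1 + move S δ n j)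
      - (Real.log (S T j) - Real.log (S 0 j))| ≤ 2 * δ := by
  have h1 := norm_returns_last_le hS hδ T
  have h2 := abs_log_le_two_mul ((PiLp.norm_apply_le _ j).trans h1) hδ'
  rw [one_add_returns hS, Real.log_div (hS.2 _ _).ne' (hS.2 _ _).ne'] at h2
  rw [sum_log_one_add_move hS, ← abs_neg]
  convert h2 using 2
  ring

lemma trace_quadVar_move (hS : S ∈ pricePaths d) (hδ : 0 < δ) (T : ℝ≥0) :
    (quadVar (move S δ) (numRounds S δ T)).trace = numRounds S δ T * δ ^ 2 := by
  rw [trace_quadVar, Finset.sum_congr rfl fun n hn => by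
    rw [norm_move_of_lt hS hδ T (Finset.mem_range.1 hn)]]
  simp

/-! ### Positivity of the capital and the cost of the open position -/

variable {n₀ : ℕ} {ε₀ : ℝ} {u : Fin n₀ → Vec d}

lemma le_capital (hε₀ : ε₀ ∈ Ioo (0 : ℝ) 1) (hδ : 0 < δ)
    (hu : IsTrainingData ε₀ (Metric.sphere (0 : Vec d) δ) u) (hS : S ∈ pricePaths d) (T : ℝ≥0) :
    sosCapital u (move S δ) (numRounds S δ T) * ε₀ ≤ capital u S δ T := by
  have hx : ∀ n < numRounds S δ T, ‖move S δ n‖ ≤ δ := fun n hn => (norm_move_of_lt hS hδ T hn).le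
  refine mul_le_mul_of_nonneg_left ?_ (sosCapital_pos hε₀ hδ hu hx).le
  exact hu.le_one_add_inner hε₀ hδ (fun i => ((alphaStar_spec hε₀ hδ hu hx).1.1 i).le)
    (norm_returns_last_le hS hδ T)

lemma capital_pos (hε₀ : ε₀ ∈ Ioo (0 : ℝ) 1) (hδ : 0 < δ)
    (hu : IsTrainingData ε₀ (Metric.sphere (0 : Vec d) δ) u) (hS : S ∈ pricePaths d) (T : ℝ≥0) :
    0 < capital u S δ T :=
  (mul_pos (sosCapital_pos hε₀ hδ hu fun _ hn => (norm_move_of_lt hS hδ T hn).le)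
    hε₀.1).trans_le (le_capital hε₀ hδ hu hS T)

end

/-! ### Asymptotics -/

section

variable {d n₀ : ℕ} {S : ℝ≥0 → Vec d} {δ : ℝ}

lemma tendsto_rpow_neg_add_log_atTop {c p : ℝ} (hc : 0 < c) (hp : 0 < p) (k b : ℝ) :
    Tendsto (fun δ : ℝ => c * δ ^ (-p) + k * Real.log δ + b) (𝓝[>] 0) atTop := by
  have h1 : Tendsto (fun δ : ℝ => δ ^ (-p)) (𝓝[>] 0) atTop :=
    tendsto_rpow_neg_nhdsGT_zero (by linarith)
  have h2 : Tendsto (fun δ : ℝ => c + k * (Real.log δ * δ ^ p)) (𝓝[>] 0) (𝓝 c) := by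
    simpa using ((tendsto_log_mul_rpow_nhdsGT_zero hp).const_mul k).const_add c
  refine tendsto_atTop_add_const_right _ b ((h1.atTop_mul_pos hc h2).congr' ?_)
  filter_upwards [self_mem_nhdsWithin] with δ hδ
  have h3 : δ ^ (-p) * δ ^ p = 1 := by
    rw [← Real.rpow_add hδ, neg_add_cancel, Real.rpow_zero]
  linear_combination k * Real.log δ * h3

lemma exists_bounds_of_mem_holderPaths {H : ℝ} {T : ℝ≥0} (hS : S ∈ holderPaths d H T) :
    ∃ c C : ℝ, 0 < c ∧ 0 < C ∧ ∀ᶠ δ in 𝓝[>] (0 : ℝ),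
      c * δ ^ (2 - 1 / H) ≤ numRounds S δ T * δ ^ 2 ∧
      numRounds S δ T * δ ^ 2 ≤ C * δ ^ (2 - 1 / H) := by
  obtain ⟨hp, hinf, hsup⟩ := hS
  obtain ⟨a, ha0, ha⟩ := exists_between hinf
  obtain ⟨b, hb, hbt⟩ := exists_between hsup
  have hat : a ≠ ⊤ := (ha.trans_le le_top).ne
  have hb0 : b ≠ 0 := (pos_of_gt hb).ne'
  refine ⟨a.toReal, b.toReal, ENNReal.toReal_pos ha0.ne' hat, ENNReal.toReal_pos hb0 hbt.ne, ?_⟩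
  filter_upwards [self_mem_nhdsWithin, eventually_lt_of_lt_liminf ha,
    eventually_lt_of_limsup_lt hb] with δ hδ h1 h2
  have hδq : 0 < δ ^ (2 - 1 / H) := Real.rpow_pos_of_pos hδ _
  rw [scaledVar, trace_quadVar_move hp hδ] at h1 h2
  have h3 := (ENNReal.lt_ofReal_iff_toReal_lt hat).1 h1
  have h4 := (ENNReal.ofReal_lt_iff_lt_toReal (by positivity) hbt.ne).1 h2
  exact ⟨((lt_div_iff₀ hδq).1 h3).le, ((div_lt_iff₀ hδq).1 h4).le⟩

lemma exists_sq_le_sum_sq_move (hS : S ∈ pricePaths d) (hδ : 0 < δ) (T : ℝ≥0) (hd : 0 < d) :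
    ∃ j, numRounds S δ T * δ ^ 2 / d
      ≤ ∑ n ∈ Finset.range (numRounds S δ T), (move S δ n j) ^ 2 := by
  have : Nonempty (Fin d) := ⟨⟨0, hd⟩⟩
  have hsum : ∑ _j : Fin d, numRounds S δ T * δ ^ 2 / (d : ℝ)
      ≤ ∑ j, ∑ n ∈ Finset.range (numRounds S δ T), (move S δ n j) ^ 2 := by
    have hd' : (d : ℝ) ≠ 0 := by positivity
    rw [Finset.sum_comm, Finset.sum_congr rfl fun n _ =>
      (EuclideanSpace.real_norm_sq_eq (move S δ n)).symm, ← trace_quadVar,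
      trace_quadVar_move hS hδ, Finset.sum_const, Finset.card_univ, Fintype.card_fin,
      nsmul_eq_mul, mul_div_cancel₀ _ hd']
  obtain ⟨j, -, hj⟩ := Finset.exists_le_of_sum_le Finset.univ_nonempty hsum
  exact ⟨j, hj⟩

/-! ### Constant proportions used as benchmarks -/

variable {ε₀ : ℝ} {u : Fin n₀ → Vec d}

lemma neg_card_le_sum_log {α : Vec d} (h : ∀ i, |inner ℝ α (u i)| ≤ 1 / 2) :
    -(n₀ : ℝ) ≤ ∑ i, Real.log (1 + inner ℝ α (u i)) := by
  calc -(n₀ : ℝ) = ∑ _i : Fin n₀, (-1 : ℝ) := by simp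
    _ ≤ _ := Finset.sum_le_sum fun i _ => neg_one_le_log (h i)

lemma abs_inner_single_le (j : Fin d) (a : ℝ) (v : Vec d) :
    |inner ℝ (EuclideanSpace.single j a) v| ≤ |a| * ‖v‖ := by
  simpa using abs_real_inner_le_norm (EuclideanSpace.single j a) v

lemma inner_single_left_real (j : Fin d) (a : ℝ) (v : Vec d) :
    inner ℝ (EuclideanSpace.single j a) v = a * v j := by
  simp [EuclideanSpace.inner_single_left]

lemma mem_admissible_of_abs_inner_le (hε₀ : ε₀ ∈ Ioo (0 : ℝ) 1) (hδ : 0 < δ)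
    (hu : IsTrainingData ε₀ (Metric.sphere (0 : Vec d) δ) u) (hS : S ∈ pricePaths d) (T : ℝ≥0)
    {α : Vec d} (h : ∀ i, |inner ℝ α (u i)| ≤ 1 / 2) :
    α ∈ admissible u (move S δ) (numRounds S δ T) := by
  refine (mem_admissible_iff hε₀ hδ hu fun n hn => (norm_move_of_lt hS hδ T hn).le).2 fun i => ?_
  linarith [(abs_le.1 (h i)).1]

/-- Betting one half on the most volatile asset gains from large quadratic variation. -/
lemma exists_logCapital_ge_quadVar (hε₀ : ε₀ ∈ Ioo (0 : ℝ) 1) (hδ : 0 < δ)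
    (hu : IsTrainingData ε₀ (Metric.sphere (0 : Vec d) δ) u) (hS : S ∈ pricePaths d) (T : ℝ≥0)
    (hd : 0 < d) {M : ℝ} (huM : ∀ i, ‖u i‖ ≤ M * δ) (hδ' : δ ≤ 1 / 2) (hMδ : M * δ ≤ 1) :
    ∃ β ∈ admissible u (move S δ) (numRounds S δ T),
      numRounds S δ T * δ ^ 2 / d / 18 - (n₀ + 1 + ∑ j, |Real.log (S T j) - Real.log (S 0 j)|)
        ≤ logCapital u (move S δ) (numRounds S δ T) β := by
  obtain ⟨j, hj⟩ := exists_sq_le_sum_sq_move hS hδ T hd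
  have hui : ∀ i, |inner ℝ (EuclideanSpace.single j (1 / 2 : ℝ)) (u i)| ≤ 1 / 2 := fun i => by
    refine (abs_inner_single_le _ _ _).trans ?_
    rw [abs_of_pos (by norm_num)]
    linarith [huM i]
  refine ⟨_, mem_admissible_of_abs_inner_le hε₀ hδ hu hS T hui, ?_⟩
  have h1 := neg_card_le_sum_log hui
  have h2 : ∑ n ∈ Finset.range (numRounds S δ T),
      (Real.log (1 + move S δ n j) / 2 + move S δ n j ^ 2 / 18) ≤
      ∑ n ∈ Finset.range (numRounds S δ T),
        Real.log (1 + inner ℝ (EuclideanSpace.single j (1 / 2 : ℝ)) (move S δ n)) := by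
    refine Finset.sum_le_sum fun n hn => ?_
    rw [inner_single_left_real, one_div_mul_eq_div]
    exact half_log_add_sq_le_log (((PiLp.norm_apply_le _ j).trans
      (norm_move_of_lt hS hδ T (Finset.mem_range.1 hn)).le).trans hδ')
  rw [Finset.sum_add_distrib, ← Finset.sum_div, ← Finset.sum_div] at h2
  have h3 := (abs_le.1 (abs_sum_log_sub_le hS hδ hδ' T j)).1
  -- The asset j may vary with δ; summing over all assets keeps the error independent of δ.
  have h4 := Finset.single_le_sum (f := fun j => |Real.log (S T j) - Real.log (S 0 j)|)
    (fun j _ => abs_nonneg _) (Finset.mem_univ j)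
  have h5 := neg_abs_le (Real.log (S T j) - Real.log (S 0 j))
  have h6 := abs_nonneg (Real.log (S T j) - Real.log (S 0 j))
  rw [logCapital]
  simp only at h4
  linarith

/-- Betting on the trend of one asset gains when the quadratic variation is small. -/
lemma exists_logCapital_ge_trend (hε₀ : ε₀ ∈ Ioo (0 : ℝ) 1) (hδ : 0 < δ)
    (hu : IsTrainingData ε₀ (Metric.sphere (0 : Vec d) δ) u) (hS : S ∈ pricePaths d) (T : ℝ≥0)
    (j : Fin d) {M s : ℝ} (hs : 0 ≤ s) (huM : ∀ i, ‖u i‖ ≤ M * δ) (hδ' : δ ≤ 1 / 2)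
    (hsδ : s * δ ≤ 1 / 2) (hMδ : s * (M * δ) ≤ 1 / 2) :
    ∃ β ∈ admissible u (move S δ) (numRounds S δ T),
      s * (|Real.log (S T j) - Real.log (S 0 j)| - 2 * δ - 2 * (numRounds S δ T * δ ^ 2))
          - 2 * s ^ 2 * (numRounds S δ T * δ ^ 2) - n₀
        ≤ logCapital u (move S δ) (numRounds S δ T) β := by
  set N := numRounds S δ T
  set ℓ := Real.log (S T j) - Real.log (S 0 j)
  obtain ⟨σ, hσ, hσℓ⟩ : ∃ σ : ℝ, |σ| = 1 ∧ σ * ℓ = |ℓ| := by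
    rcases le_total 0 ℓ with h | h
    · exact ⟨1, by simp, by rw [abs_of_nonneg h, one_mul]⟩
    · exact ⟨-1, by simp, by rw [abs_of_nonpos h, neg_one_mul]⟩
  have hσ2 : σ ^ 2 = 1 := by rw [← sq_abs, hσ, one_pow]
  have hsσ : |s * σ| = s := by rw [abs_mul, hσ, abs_of_nonneg hs, mul_one]
  have hui : ∀ i, |inner ℝ (EuclideanSpace.single j (s * σ)) (u i)| ≤ 1 / 2 := fun i => by
    refine (abs_inner_single_le _ _ _).trans ?_
    rw [hsσ]
    exact (mul_le_mul_of_nonneg_left (huM i) hs).trans hMδ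
  refine ⟨_, mem_admissible_of_abs_inner_le hε₀ hδ hu hS T hui, ?_⟩
  have h1 := neg_card_le_sum_log hui
  have h2 : ∑ n ∈ Finset.range N,
      (s * (σ * Real.log (1 + move S δ n j) - 2 * δ ^ 2) - 2 * s ^ 2 * δ ^ 2) ≤
      ∑ n ∈ Finset.range N,
        Real.log (1 + inner ℝ (EuclideanSpace.single j (s * σ)) (move S δ n)) := by
    refine Finset.sum_le_sum fun n hn => ?_
    have hm : |move S δ n j| ≤ δ := (PiLp.norm_apply_le _ j).trans
      (norm_move_of_lt hS hδ T (Finset.mem_range.1 hn)).le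
    rw [inner_single_left_real]
    set z := move S δ n j
    have hz2 : z ^ 2 ≤ δ ^ 2 := by rw [← sq_abs]; gcongr
    have h3 : |s * σ * z| ≤ 1 / 2 := by
      rw [abs_mul, hsσ]
      exact (mul_le_mul_of_nonneg_left hm hs).trans hsδ
    have h4 := sub_two_mul_sq_le_log h3
    -- Passing from simple returns to log returns, which telescope, costs 2δ² per round.
    have h5 : σ * Real.log (1 + z) ≤ σ * z + 2 * δ ^ 2 := by
      have h6 := sub_two_mul_sq_le_log (hm.trans hδ')
      have h7 := Real.log_le_sub_one_of_pos (x := 1 + z) (by linarith [(abs_le.1 hm).1])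
      have h8 : |Real.log (1 + z) - z| ≤ 2 * δ ^ 2 := abs_le.2 ⟨by linarith, by nlinarith⟩
      have h9 := le_abs_self (σ * (Real.log (1 + z) - z))
      rw [abs_mul, hσ, one_mul] at h9
      linarith
    have h10 : (s * σ * z) ^ 2 ≤ s ^ 2 * δ ^ 2 := by
      rw [mul_pow, mul_pow, hσ2, mul_one]; gcongr
    nlinarith [mul_le_mul_of_nonneg_left h5 hs]
  rw [Finset.sum_sub_distrib, ← Finset.mul_sum, Finset.sum_sub_distrib, ← Finset.mul_sum] at h2
  simp only [Finset.sum_const, Finset.card_range, nsmul_eq_mul] at h2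
  have h3 : |ℓ| - 2 * δ ≤ σ * ∑ n ∈ Finset.range N, Real.log (1 + move S δ n j) := by
    have h4 := abs_sum_log_sub_le hS hδ hδ' T j
    have h5 := neg_abs_le (σ * (∑ n ∈ Finset.range N, Real.log (1 + move S δ n j) - ℓ))
    rw [abs_mul, hσ, one_mul, mul_sub, hσℓ] at h5
    linarith
  have h4 := mul_le_mul_of_nonneg_left h3 hs
  rw [logCapital]
  nlinarith

end

/-! ### Divergence of the capital -/

section

variable {d n₀ : ℕ} {S : ℝ≥0 → Vec d} {ε₀ : ℝ} {u : ℝ → Fin n₀ → Vec d} {T : ℝ≥0}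

/-- If some constant proportion grows polynomially in `1 / δ`, then so does the capital of the
sequential optimizing strategy. -/
lemma tendsto_capital_atTop (hε₀ : ε₀ ∈ Ioo (0 : ℝ) 1)
    (hu : ∀ δ > 0, IsTrainingData ε₀ (Metric.sphere (0 : Vec d) δ) (u δ))
    (hS : S ∈ pricePaths d) {M : ℝ} (hM : 0 ≤ M)
    (huM : ∀ᶠ δ in 𝓝[>] (0 : ℝ), ∀ i, ‖u δ i‖ ≤ M * δ) {c p b a k : ℝ} (hc : 0 < c) (hp : 0 < p)
    (hN : ∀ᶠ δ in 𝓝[>] (0 : ℝ), Real.log (d + numRounds S δ T) ≤ a + k * Real.log δ)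
    (hβ : ∀ᶠ δ in 𝓝[>] (0 : ℝ), ∃ β ∈ admissible (u δ) (move S δ) (numRounds S δ T),
      c * δ ^ (-p) - b ≤ logCapital (u δ) (move S δ) (numRounds S δ T) β) :
    Tendsto (fun δ : ℝ => capital (u δ) S δ T) (𝓝[>] 0) atTop := by
  set R := ((2 + M) / ε₀) ^ 2 * d with hR
  have hR0 : 0 ≤ R := by positivity
  have h := tendsto_rpow_neg_add_log_atTop hc hp (-(R * k))
    (Real.log ε₀ - b - n₀ * Real.log (1 + M) - R * a)
  refine tendsto_atTop_mono' _ ?_ (Real.tendsto_exp_atTop.comp h)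
  filter_upwards [self_mem_nhdsWithin, huM, hN, hβ] with δ hδ h1 h2 ⟨β, h3, h4⟩
  have hδ : 0 < δ := hδ
  have hx : ∀ n < numRounds S δ T, ‖move S δ n‖ ≤ δ := fun n hn => (norm_move_of_lt hS hδ T hn).le
  have hsos := sosCapital_pos hε₀ hδ (hu δ hδ) hx
  have h5 := logCapital_le_log_sosCapital hε₀ hδ (hu δ hδ) hM h1 hx h3
  rw [← mul_assoc, ← hR] at h5
  have h6 := mul_le_mul_of_nonneg_left h2 hR0
  refine le_trans ?_ (le_capital hε₀ hδ (hu δ hδ) hS T)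
  rw [← Real.exp_log (mul_pos hsos hε₀.1), Real.log_mul hsos.ne' hε₀.1.ne']
  exact Real.exp_le_exp.2 (by linarith)

lemma exists_norm_le_mul (hu_order : ∀ i, (fun δ : ℝ => u δ i) =O[𝓝[>] 0] (fun δ : ℝ => δ)) :
    ∃ M : ℝ, 0 ≤ M ∧ ∀ᶠ δ in 𝓝[>] (0 : ℝ), ∀ i, ‖u δ i‖ ≤ M * δ := by
  choose m hm hm' using fun i => (hu_order i).exists_nonneg
  refine ⟨∑ i, m i, Finset.sum_nonneg fun i _ => hm i, ?_⟩
  filter_upwards [self_mem_nhdsWithin, eventually_all.2 fun i => (hm' i).bound] with δ hδ h i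
  have hδ : 0 < δ := hδ
  refine (h i).trans ?_
  rw [Real.norm_of_nonneg hδ.le]
  gcongr
  exact Finset.single_le_sum (fun i _ => hm i) (Finset.mem_univ i)

lemma tendsto_capital_of_mem_holderPaths (hε₀ : ε₀ ∈ Ioo (0 : ℝ) 1)
    (hu : ∀ δ > 0, IsTrainingData ε₀ (Metric.sphere (0 : Vec d) δ) (u δ))
    (hu_order : ∀ i, (fun δ : ℝ => u δ i) =O[𝓝[>] 0] (fun δ : ℝ => δ)) {H : ℝ}
    (hH : H ∈ Ioo (0 : ℝ) 1) (hH' : H ≠ 1 / 2) (hS : S ∈ holderPaths d H T)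
    (hST : 1 / 2 < H → S T ≠ S 0) :
    Tendsto (fun δ : ℝ => capital (u δ) S δ T) (𝓝[>] 0) atTop := by
  obtain ⟨M, hM, huM⟩ := exists_norm_le_mul hu_order
  obtain ⟨c, C, hc, hC, hcC⟩ := exists_bounds_of_mem_holderPaths hS
  have hSp := hS.1
  have hid : Tendsto (fun δ : ℝ => δ) (𝓝[>] 0) (𝓝 0) :=
    tendsto_nhdsWithin_of_tendsto_nhds tendsto_id
  have hlog : ∀ᶠ δ in 𝓝[>] (0 : ℝ), Real.log (d + numRounds S δ T)
      ≤ Real.log (d + C) + -(1 / H) * Real.log δ := by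
    filter_upwards [self_mem_nhdsWithin, hcC, hid.eventually_le_const one_pos] with δ hδ h h1
    have hδ : 0 < δ := hδ
    have hN : (numRounds S δ T : ℝ) ≤ C * δ ^ (-(1 / H)) := by
      have e : δ ^ (2 - 1 / H) = δ ^ (-(1 / H)) * δ ^ 2 := by
        rw [← Real.rpow_natCast, ← Real.rpow_add hδ]; congr 1; push_cast; ring
      have h2 := h.2
      rw [e, ← mul_assoc] at h2
      exact le_of_mul_le_mul_right h2 (by positivity)
    -- The lower Hölder bound gives N > 0, so d + N is positive even when d = 0.
    have hN0 : 0 < (numRounds S δ T : ℝ) :=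
      pos_of_mul_pos_left (lt_of_lt_of_le (by positivity) h.1) (by positivity)
    rw [← Real.log_rpow hδ, ← Real.log_mul (by positivity) (by positivity)]
    refine Real.log_le_log (by positivity) ?_
    have h3 : 1 ≤ δ ^ (-(1 / H)) :=
      Real.one_le_rpow_of_pos_of_le_one_of_nonpos hδ h1 (by have := hH.1; simp; positivity)
    nlinarith [Nat.cast_nonneg (α := ℝ) d]
  have hMδ : Tendsto (fun δ : ℝ => M * δ) (𝓝[>] 0) (𝓝 0) := by simpa using hid.const_mul M
  rcases hH'.lt_or_gt with hlt | hgt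
  · have hp : 0 < 1 / H - 2 := by
      rw [sub_pos, lt_div_iff₀ hH.1]; linarith
    have hd : 0 < d := by
      rcases Nat.eq_zero_or_pos d with rfl | hd
      · obtain ⟨δ, hδ, h⟩ := (eventually_mem_nhdsWithin.and hcC).exists
        have hδ : 0 < δ := hδ
        have h0 := trace_quadVar_move hSp hδ T
        rw [Matrix.trace_fin_zero] at h0
        have := h.1
        rw [← h0] at this
        exact absurd this (not_le.2 (by positivity))
      · exact hd
    refine tendsto_capital_atTop hε₀ hu hSp hM huM (c := c / d / 18) (by positivity) hp
      (b := n₀ + 1 + ∑ j, |Real.log (S T j) - Real.log (S 0 j)|) hlog ?_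
    filter_upwards [self_mem_nhdsWithin, huM, hcC, hid.eventually_le_const one_half_pos,
      hMδ.eventually_le_const one_pos] with δ hδ h1 h2 h3 h4
    obtain ⟨β, hβ, hβ'⟩ := exists_logCapital_ge_quadVar hε₀ hδ (hu δ hδ) hSp T hd h1 h3 h4
    refine ⟨β, hβ, le_trans ?_ hβ'⟩
    have e : c / d / 18 * δ ^ (-(1 / H - 2)) = c * δ ^ (2 - 1 / H) / d / 18 := by
      rw [neg_sub]; ring
    rw [e]
    have := h2.1
    gcongr
  · obtain ⟨j, hj⟩ : ∃ j, S T j ≠ S 0 j := by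
      by_contra! h
      exact hST hgt (PiLp.ext h)
    set ℓ := |Real.log (S T j) - Real.log (S 0 j)| with hℓ
    have hℓ0 : 0 < ℓ := abs_pos.2 <| sub_ne_zero.2 fun h =>
      hj (Real.log_injOn_pos (hSp.2 T j) (hSp.2 0 j) h)
    set q := 2 - 1 / H with hq
    have hq0 : 0 < q := by
      rw [hq, sub_pos, div_lt_iff₀ hH.1]; linarith
    have hq1 : 0 < 1 - q := by
      have : 1 < 1 / H := by rw [lt_div_iff₀ hH.1]; linarith [hH.2]
      linarith
    have hpow : ∀ r : ℝ, 0 < r → Tendsto (fun δ : ℝ => δ ^ r) (𝓝[>] 0) (𝓝 0) := fun r hr => by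
      have := (Real.continuousAt_rpow_const 0 r (Or.inr hr.le)).tendsto
      rw [Real.zero_rpow hr.ne'] at this
      exact tendsto_nhdsWithin_of_tendsto_nhds this
    -- With s = e δ^(-q), the trend gains at least sℓ/2 and the quadratic loss is at most 2s²Cδ^q =
    -- 2eCs; this e makes the loss sℓ/4. Since q < 1, sδ tends to 0, so the bet is eventually
    -- admissible.
    set e := ℓ / (8 * C) with he
    have he0 : 0 < e := by positivity
    have hs1 : Tendsto (fun δ : ℝ => e * δ ^ (1 - q)) (𝓝[>] 0) (𝓝 0) := by
      simpa using (hpow _ hq1).const_mul e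
    have hs2 : Tendsto (fun δ : ℝ => M * (e * δ ^ (1 - q))) (𝓝[>] 0) (𝓝 0) := by
      simpa using hs1.const_mul M
    have hs3 : Tendsto (fun δ : ℝ => 2 * δ + 2 * (C * δ ^ q)) (𝓝[>] 0) (𝓝 0) := by
      simpa using (hid.const_mul 2).add (((hpow _ hq0).const_mul C).const_mul 2)
    refine tendsto_capital_atTop hε₀ hu hSp hM huM (c := e * ℓ / 4) (by positivity) hq0
      (b := n₀) hlog ?_
    filter_upwards [self_mem_nhdsWithin, huM, hcC, hid.eventually_le_const one_half_pos,
      hs1.eventually_le_const one_half_pos, hs2.eventually_le_const one_half_pos,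
      hs3.eventually_le_const (half_pos hℓ0)] with δ hδ h1 h2 h3 h4 h5 h6
    have hδ : 0 < δ := hδ
    have hsδ : e * δ ^ (-q) * δ = e * δ ^ (1 - q) := by
      rw [mul_assoc, ← Real.rpow_add_one hδ.ne']; congr 2; ring
    obtain ⟨β, hβ, hβ'⟩ := exists_logCapital_ge_trend hε₀ hδ (hu δ hδ) hSp T j
      (s := e * δ ^ (-q)) (by positivity) h1 h3 (by rwa [hsδ])
      (by rwa [mul_left_comm, hsδ])
    refine ⟨β, hβ, le_trans ?_ hβ'⟩
    rw [← hℓ]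
    have hw : 0 < δ ^ (-q) := by positivity
    have hinv : δ ^ (-q) * δ ^ q = 1 := by
      rw [← Real.rpow_add hδ, neg_add_cancel, Real.rpow_zero]
    have h7 : 2 * (e * δ ^ (-q)) ^ 2 * (numRounds S δ T * δ ^ 2) ≤ e * δ ^ (-q) * (ℓ / 4) := by
      calc _ ≤ 2 * (e * δ ^ (-q)) ^ 2 * (C * δ ^ q) :=
          mul_le_mul_of_nonneg_left h2.2 (by positivity)
        _ = 2 * e ^ 2 * C * δ ^ (-q) * (δ ^ (-q) * δ ^ q) := by ring
        _ = e * δ ^ (-q) * (ℓ / 4) := by rw [hinv, he]; field_simp; ring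
    have h8 : e * δ ^ (-q) * (ℓ / 2)
        ≤ e * δ ^ (-q) * (ℓ - 2 * δ - 2 * (numRounds S δ T * δ ^ 2)) := by
      gcongr
      linarith [h2.2]
    linarith

end

end TradingGame

open TradingGame
theorem theorem4p1 {d n₀ : ℕ} (ε₀ : ℝ) (hε₀ : ε₀ ∈ Ioo (0 : ℝ) 1)
    (u : ℝ → Fin n₀ → Vec d)
    (hu : ∀ δ > 0, IsTrainingData ε₀ (Metric.sphere (0 : Vec d) δ) (u δ))
    (hu_order : ∀ i, (fun δ : ℝ => u δ i) =O[𝓝[>] 0] (fun δ : ℝ => δ)) :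
    (∀ S ∈ pricePaths d, ∀ δ > 0, ∀ t : ℝ≥0, 0 ≤ capital (u δ) S δ t) ∧
    ∀ (T : ℝ≥0) (A H : ℝ), 0 < T → 0 < A → H ∈ Ioo (0 : ℝ) 1 → H ≠ 1 / 2 →
      ∀ S ∈ pricePaths d,
        S ∈ (quietPaths d A T)ᶜ ∩ smallBetPaths u T ∩ holderPaths d H T →
        (1 / 2 < H → S T ≠ S 0) →
        Tendsto (fun δ : ℝ => capital (u δ) S δ T) (𝓝[>] 0) atTop := by
  refine ⟨fun S hS δ hδ t => (capital_pos hε₀ hδ (hu δ hδ) hS t).le, ?_⟩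
  intro T A H _ _ hH hH' S _ hS hST
  exact tendsto_capital_of_mem_holderPaths hε₀ hu hu_order hH hH' hS.2 hST
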